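/- Let $\omega=\exp(2\pi i/3)$. For positive integers $k_1,\ldots,k_n$ and $a_1,\ldots,a_n\in\mathbb{Z}/3\mathbb{Z}$, with $k_1\ge 2$ or $a_1\neq 0$, let $$\zeta^{(3)}\left(\fbox{$k_1$},\ldots,\fbox{$k_n$}\right)=\sum_{m_1>\cdots>m_n>0}\frac{\omega^{a_1m_1+\cdots+a_nm_n}}{m_1^{k_1}\cdots m_n^{k_n}}$$ be the multiple $L$-value of level $3$, where the entry $\fbox{$k_i$}$ is written $k_i$, $\overline{k_i}$ or $\widetilde{k_i}$ according as $a_i=0$, $1$ or $2$; the sum is the limit, as $M\to\infty$, of the sums over $M>m_1>\cdots>m_n>0$. For $k_1\ge 2$ let $\zeta(k_1,\ldots,k_n)=\sum_{m_1>\cdots>m_n>0}m_1^{-k_1}\cdots m_n^{-k_n}$ be the multiple zeta value, so that $\zeta(k)$ is the Riemann zeta value. Then for every integer $k\ge 3$ all the series occurring below converge, and \begin{align*} &\sum_{j=2}^{k-1}\zeta(j,k-j)=\zeta(k),\\ &\sum_{j=2}^{k-1}\zeta^{(3)}(\overline{j},k-j)=\zeta^{(3)}(\overline{1},\overline{k-1})-\zeta^{(3)}(\overline{1},k-1)+\zeta^{(3)}(\overline{k-1},\overline{1})-\zeta^{(3)}(\overline{k-1},1)+\zeta^{(3)}(\widetilde{k}),\\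 &\sum_{j=2}^{k-1}\zeta^{(3)}(\widetilde{j},k-j)=\zeta^{(3)}(\widetilde{1},\widetilde{k-1})-\zeta^{(3)}(\widetilde{1},k-1)+\zeta^{(3)}(\widetilde{k-1},\widetilde{1})-\zeta^{(3)}(\widetilde{k-1},1)+\zeta^{(3)}(\overline{k}),\\ &\sum_{j=2}^{k-1}\zeta^{(3)}(j,\overline{k-j})=\zeta^{(3)}(\overline{k-1},1)-\zeta^{(3)}(\overline{k-1},\widetilde{1})+\zeta^{(3)}(\overline{k}),\\ &\sum_{j=2}^{k-1}\zeta^{(3)}(\overline{j},\overline{k-j})=\zeta^{(3)}(\overline{1},\widetilde{k-1})-\zeta^{(3)}(\overline{1},\overline{k-1})+\zeta^{(3)}(\widetilde{k-1},\overline{1})-\zeta^{(3)}(\widetilde{k-1},\widetilde{1})+\zeta(k),\\ &\sum_{j=2}^{k-1}\zeta^{(3)}(\widetilde{j},\overline{k-j})=\zeta^{(3)}(\widetilde{1},k-1)-\zeta^{(3)}(\widetilde{1},\overline{k-1})+\zeta^{(3)}(\widetilde{k}),\\ &\sum_{j=2}^{k-1}\zeta^{(3)}(j,\widetilde{k-j})=\zeta^{(3)}(\widetilde{k-1},1)-\zeta^{(3)}(\widetilde{k-1},\overline{1})+\zeta^{(3)}(\widetilde{k}),\\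 &\sum_{j=2}^{k-1}\zeta^{(3)}(\overline{j},\widetilde{k-j})=\zeta^{(3)}(\overline{1},k-1)-\zeta^{(3)}(\overline{1},\widetilde{k-1})+\zeta^{(3)}(\overline{k}),\\ &\sum_{j=2}^{k-1}\zeta^{(3)}(\widetilde{j},\widetilde{k-j})=\zeta^{(3)}(\widetilde{1},\overline{k-1})-\zeta^{(3)}(\widetilde{1},\widetilde{k-1})+\zeta^{(3)}(\overline{k-1},\widetilde{1})-\zeta^{(3)}(\overline{k-1},\overline{1})+\zeta(k). \end{align*} -/

import Mathlib

open Filter Topology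

/-- The fixed primitive `N`-th root of unity `ω_N = exp(2πi/N)`. -/
noncomputable def rootOmega (N : ℕ) : ℂ :=
  Complex.exp (2 * (Real.pi : ℂ) * Complex.I / (N : ℂ))

/-- The partial sum of the series of `L_*(k₁,…,kₙ; a₁,…,aₙ)` at level `N`, over all
`M > m₁ > ⋯ > mₙ > 0`. The index `0 : Fin n` carries the largest variable `m₁`. -/
noncomputable def multipleLPartial (N : ℕ) {n : ℕ} (k : Fin n → ℕ) (a : Fin n → ZMod N)
    (M : ℕ) : ℂ :=
  open Classical in
  ∑ m ∈ (Fintype.piFinset fun _ : Fin n => Finset.Ico 1 M).filter (fun m => StrictAnti m),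
    ∏ i, rootOmega N ^ ((a i).val * m i) / (m i : ℂ) ^ k i

/-- The series of `L_*(k₁,…,kₙ; a₁,…,aₙ)` converges (as a limit of the partial sums
over `m₁ < M`; for `k₁ = 1`, `a₁ ≠ 0` the convergence is only conditional). -/
def MultipleLConverges (N : ℕ) {n : ℕ} (k : Fin n → ℕ) (a : Fin n → ZMod N) : Prop :=
  ∃ z : ℂ, Tendsto (multipleLPartial N k a) atTop (𝓝 z)

/-- The multiple `L`-value `L_*(k₁,…,kₙ; a₁,…,aₙ)` of level `N`, that is
`∑_{m₁ > ⋯ > mₙ > 0} ω^{a₁m₁ + ⋯ + aₙmₙ} / (m₁^{k₁} ⋯ mₙ^{kₙ})`. -/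
noncomputable def multipleL (N : ℕ) {n : ℕ} (k : Fin n → ℕ) (a : Fin n → ZMod N) : ℂ :=
  limUnder atTop (multipleLPartial N k a)

/-- The multiple zeta value `ζ(k₁,…,kₙ)`: the multiple `L`-value of level `1`. -/
noncomputable def multipleZeta {n : ℕ} (k : Fin n → ℕ) : ℂ :=
  multipleL 1 k (fun _ => 0)

/-- The multiple `L`-value of level `3`, written `ζ⁽³⁾(…)`: in the usual notation the entry
`kᵢ` is undecorated, barred or carries a tilde according as `aᵢ` is `0`, `1` or `2`. -/
noncomputable def zetaThree {n : ℕ} (k : Fin n → ℕ) (a : Fin n → ZMod 3) : ℂ :=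
  multipleL 3 k a

/-! With `u = 1/m`, `v = 1/n`, `w = 1/(m-n)`, partial fractions expand `v^(k-1) w - u^(k-1) w` into
the terms `u^j v^(k-j)`, `1 ≤ j ≤ k-1`. Weighting by `x^m y^n` and summing over `M > m > n > 0`
gives an exact finite identity, `sum_doubleSum_add`. Its right side is almost a product of two
single sums: truncating at `M` instead of `M - n` costs an error that vanishes
(`tendsto_sum_mul_singleSum_sub`), and `singleSum_mul_singleSum` expands the product. All nine
formulas are cases with `x`, `y` roots of unity of order dividing 1 or 3. If `x = 1`, the two sums
with leading exponent 1 coincide and cancel before the limit, so no regularization is needed. -/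

/-! ### Finite identities for truncated sums. -/

/-- The partial sum over `0 < m < M` of the series `∑ xᵐ / mᵏ`. -/
noncomputable def singleSum (k : ℕ) (x : ℂ) (M : ℕ) : ℂ :=
  ∑ m ∈ Finset.Ico 1 M, x ^ m / (m : ℂ) ^ k

/-- The partial sum over `M > m > n > 0` of the series `∑ xᵐ yⁿ / (mᵖ n^q)`. -/
noncomputable def doubleSum (p q : ℕ) (x y : ℂ) (M : ℕ) : ℂ :=
  ∑ m ∈ Finset.Ico 1 M, ∑ n ∈ Finset.Ico 1 m, x ^ m / (m : ℂ) ^ p * (y ^ n / (n : ℂ) ^ q)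

theorem singleSum_succ {k M : ℕ} (hM : 1 ≤ M) (x : ℂ) :
    singleSum k x (M + 1) = singleSum k x M + x ^ M / (M : ℂ) ^ k :=
  Finset.sum_Ico_succ_top hM _

theorem doubleSum_succ {p q M : ℕ} (hM : 1 ≤ M) (x y : ℂ) :
    doubleSum p q x y (M + 1) =
      doubleSum p q x y M + x ^ M / (M : ℂ) ^ p * singleSum q y M := by
  rw [doubleSum, Finset.sum_Ico_succ_top hM, singleSum, Finset.mul_sum, doubleSum]

/-- The quasi-shuffle product of two truncated series. -/
theorem singleSum_mul_singleSum (p q : ℕ) (x y : ℂ) (M : ℕ) :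
    singleSum p x M * singleSum q y M =
      doubleSum p q x y M + doubleSum q p y x M + singleSum (p + q) (x * y) M := by
  rcases Nat.eq_zero_or_pos M with rfl | hM
  · simp [singleSum, doubleSum]
  induction M, hM using Nat.le_induction with
  | base => simp [singleSum, doubleSum]
  | succ M hM ih =>
    rw [singleSum_succ hM, singleSum_succ hM, singleSum_succ hM, doubleSum_succ hM,
      doubleSum_succ hM, mul_pow, pow_add, ← div_mul_div_comm]
    linear_combination ih

/-- Factor `v^(k-1) - u^(k-1)` by `v - u` and replace `w * (v - u)` by `u * v`. The term `j = 1`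
stands apart because its series may diverge. -/
theorem sum_inv_pow_mul_inv_pow {u v w : ℂ} (hw : w * (v - u) = u * v) {k : ℕ} (hk : 2 ≤ k) :
    ∑ j ∈ Finset.Icc 2 (k - 1), u ^ j * v ^ (k - j) + u * v ^ (k - 1) + u ^ (k - 1) * w =
      v ^ (k - 1) * w := by
  induction k, hk using Nat.le_induction with
  | base => norm_num; linear_combination -hw
  | succ k hk ih =>
    obtain ⟨r, rfl⟩ := Nat.exists_eq_add_of_le' hk
    have h1 : r + 2 + 1 - 1 = (r + 1) + 1 := by omega
    have h2 : r + 2 - 1 = r + 1 := by omega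
    rw [h1, Finset.sum_Icc_succ_top (by omega)]
    rw [h2] at ih
    have h3 : ∑ j ∈ Finset.Icc 2 (r + 1), u ^ j * v ^ (r + 2 + 1 - j) =
        v * ∑ j ∈ Finset.Icc 2 (r + 1), u ^ j * v ^ (r + 2 - j) := by
      rw [Finset.mul_sum]
      refine Finset.sum_congr rfl fun j hj => ?_
      rw [Finset.mem_Icc] at hj
      rw [show r + 2 + 1 - j = (r + 2 - j) + 1 by omega]
      ring
    rw [h3, show r + 2 + 1 - (r + 1 + 1) = 1 by omega]
    linear_combination v * ih - u ^ (r + 1) * hw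

theorem sum_triangle_reflect (f : ℕ → ℕ → ℂ) (M : ℕ) :
    ∑ m ∈ Finset.Ico 1 M, ∑ n ∈ Finset.Ico 1 m, f m n =
      ∑ m ∈ Finset.Ico 1 M, ∑ n ∈ Finset.Ico 1 m, f m (m - n) := by
  refine Finset.sum_congr rfl fun m hm => ?_
  rw [Finset.mem_Ico] at hm
  rw [Finset.sum_Ico_reflect (f m) 1 (by omega : m ≤ m + 1)]
  simp

theorem sum_triangle_sub (f : ℕ → ℕ → ℂ) (M : ℕ) :
    ∑ m ∈ Finset.Ico 1 M, ∑ n ∈ Finset.Ico 1 m, f (m - n) n =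
      ∑ n ∈ Finset.Ico 1 M, ∑ l ∈ Finset.Ico 1 (M - n), f l n := by
  rw [Finset.sum_sigma', Finset.sum_sigma']
  refine Finset.sum_nbij' (fun z => ⟨z.2, z.1 - z.2⟩) (fun z => ⟨z.1 + z.2, z.1⟩) ?_ ?_ ?_ ?_ ?_
  · rintro ⟨a, b⟩ h
    simp only [Finset.mem_sigma, Finset.mem_Ico] at h ⊢
    omega
  · rintro ⟨a, b⟩ h
    simp only [Finset.mem_sigma, Finset.mem_Ico] at h ⊢
    omega
  · rintro ⟨a, b⟩ h
    simp only [Finset.mem_sigma, Finset.mem_Ico] at h ⊢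
    rw [Nat.add_sub_cancel' (by omega)]
  · rintro ⟨a, b⟩ h
    simp
  · rintro ⟨a, b⟩ h
    rfl

/-- The truncated form of the sum formula, by partial fractions. -/
theorem sum_doubleSum_add {k : ℕ} (hk : 2 ≤ k) (x : ℂ) {y : ℂ} (hy : y ≠ 0) (M : ℕ) :
    ∑ j ∈ Finset.Icc 2 (k - 1), doubleSum j (k - j) x y M + doubleSum 1 (k - 1) x y M
        + doubleSum (k - 1) 1 (x * y) y⁻¹ M =
      ∑ n ∈ Finset.Ico 1 M, (x * y) ^ n / (n : ℂ) ^ (k - 1) * singleSum 1 x (M - n) := by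
  -- Reflecting `n ↦ m - n` in the inner sum produces the factor `1/(m-n)`.
  have h3 : doubleSum (k - 1) 1 (x * y) y⁻¹ M = ∑ m ∈ Finset.Ico 1 M, ∑ n ∈ Finset.Ico 1 m,
      x ^ m * y ^ n * ((m : ℂ)⁻¹ ^ (k - 1) * ((m : ℂ) - n)⁻¹) := by
    rw [doubleSum, sum_triangle_reflect]
    refine Finset.sum_congr rfl fun m hm => Finset.sum_congr rfl fun n hn => ?_
    simp only [Finset.mem_Ico] at hm hn
    have e : y ^ m = y ^ n * y ^ (m - n) := by rw [← pow_add, Nat.add_sub_cancel' hn.2.le]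
    rw [Nat.cast_sub hn.2.le, mul_pow, e, inv_pow, inv_pow]
    field_simp
  -- Here the substitution is `m = l + n`, so `l < M - n`.
  have hr : ∑ n ∈ Finset.Ico 1 M, (x * y) ^ n / (n : ℂ) ^ (k - 1) * singleSum 1 x (M - n) =
      ∑ m ∈ Finset.Ico 1 M, ∑ n ∈ Finset.Ico 1 m,
        x ^ m * y ^ n * ((n : ℂ)⁻¹ ^ (k - 1) * ((m : ℂ) - n)⁻¹) := by
    simp only [singleSum, Finset.mul_sum]
    rw [← sum_triangle_sub fun l n => (x * y) ^ n / (n : ℂ) ^ (k - 1) * (x ^ l / (l : ℂ) ^ 1)]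
    refine Finset.sum_congr rfl fun m hm => Finset.sum_congr rfl fun n hn => ?_
    simp only [Finset.mem_Ico] at hm hn
    have e : x ^ m = x ^ n * x ^ (m - n) := by rw [← pow_add, Nat.add_sub_cancel' hn.2.le]
    rw [Nat.cast_sub hn.2.le, mul_pow, e, inv_pow]
    field_simp
  rw [h3, hr]
  simp only [doubleSum]
  rw [Finset.sum_comm, ← Finset.sum_add_distrib, ← Finset.sum_add_distrib]
  refine Finset.sum_congr rfl fun m hm => ?_
  rw [Finset.sum_comm, ← Finset.sum_add_distrib, ← Finset.sum_add_distrib]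
  refine Finset.sum_congr rfl fun n hn => ?_
  simp only [Finset.mem_Ico] at hm hn
  have hm0 : (m : ℂ) ≠ 0 := Nat.cast_ne_zero.2 (by omega)
  have hn0 : (n : ℂ) ≠ 0 := Nat.cast_ne_zero.2 (by omega)
  have hmn : (m : ℂ) - n ≠ 0 := sub_ne_zero.2 (Nat.cast_injective.ne (by omega))
  have hw : ((m : ℂ) - n)⁻¹ * ((n : ℂ)⁻¹ - (m : ℂ)⁻¹) = (m : ℂ)⁻¹ * (n : ℂ)⁻¹ := by
    field_simp
  rw [← sum_inv_pow_mul_inv_pow hw hk, mul_add, mul_add, Finset.mul_sum]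
  congr 2
  · refine Finset.sum_congr rfl fun j _ => ?_
    simp only [div_eq_mul_inv, inv_pow]
    ring
  · simp only [div_eq_mul_inv, inv_pow]
    ring

/-! ### The truncation error. -/

/-- Exactly `n` terms are lost, each of norm at most `1/(M-n)`. -/
theorem norm_singleSum_sub_le {x : ℂ} (hx : ‖x‖ ≤ 1) {n M : ℕ} (hn : n < M) :
    ‖singleSum 1 x (M - n) - singleSum 1 x M‖ ≤ n / ((M : ℝ) - n) := by
  have h0 : (0 : ℝ) < (M : ℝ) - n := sub_pos.2 (Nat.cast_lt.2 hn)
  have h := Finset.sum_Ico_consecutive (fun m : ℕ => x ^ m / (m : ℂ) ^ 1)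
    (show 1 ≤ M - n by omega) (Nat.sub_le M n)
  rw [← norm_neg, neg_sub, singleSum, singleSum, ← h, add_sub_cancel_left]
  refine (norm_sum_le_of_le (f := fun m : ℕ => x ^ m / (m : ℂ) ^ 1)
    (n := fun _ => ((M : ℝ) - n)⁻¹) _ fun m hm => ?_).trans ?_
  · rw [Finset.mem_Ico] at hm
    have h1 : (M : ℝ) - n ≤ m := by
      have : (M : ℝ) ≤ m + n := by exact_mod_cast (by omega : M ≤ m + n)
      linarith
    rw [pow_one, norm_div, norm_pow, Complex.norm_natCast, div_eq_mul_inv]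
    calc ‖x‖ ^ m * (m : ℝ)⁻¹ ≤ 1 * ((M : ℝ) - n)⁻¹ := by
          gcongr
          exact pow_le_one₀ (norm_nonneg _) hx
      _ = _ := one_mul _
  · rw [Finset.sum_const, Nat.card_Ico, nsmul_eq_mul, Nat.sub_sub_self hn.le, div_eq_mul_inv]

/-- These are Cesàro means of the null sequence `1/n`. -/
theorem tendsto_sum_inv_div :
    Tendsto (fun M : ℕ => (M : ℝ)⁻¹ * ∑ n ∈ Finset.Ico 1 M, (n : ℝ)⁻¹) atTop (𝓝 0) := by
  refine (tendsto_inv_atTop_nhds_zero_nat (𝕜 := ℝ)).cesaro.congr fun M => ?_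
  congr 1
  refine (Finset.sum_subset (fun n hn => ?_) fun n hn hn' => ?_).symm
  · simp only [Finset.mem_Ico, Finset.mem_range] at *
    omega
  · simp only [Finset.mem_Ico, Finset.mem_range] at *
    simp [show n = 0 by omega]

/-- As `k - 1 ≥ 2`, the `n`-th term is at most `1/(n(M-n)) = (1/n + 1/(M-n))/M`; the total is twice
a harmonic sum divided by `M`. -/
theorem tendsto_sum_mul_singleSum_sub {k : ℕ} (hk : 3 ≤ k) {x z : ℂ} (hx : ‖x‖ ≤ 1)
    (hz : ‖z‖ ≤ 1) :
    Tendsto (fun M : ℕ => ∑ n ∈ Finset.Ico 1 M,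
      z ^ n / (n : ℂ) ^ (k - 1) * (singleSum 1 x (M - n) - singleSum 1 x M)) atTop (𝓝 0) := by
  have h2 := tendsto_sum_inv_div.const_mul 2
  rw [mul_zero] at h2
  refine squeeze_zero_norm (fun M => ?_) h2
  have hs : ∑ n ∈ Finset.Ico 1 M, ((M : ℝ) - n)⁻¹ = ∑ n ∈ Finset.Ico 1 M, (n : ℝ)⁻¹ := by
    have h := Finset.sum_Ico_reflect (fun n : ℕ => (n : ℝ)⁻¹) 1 (Nat.le_succ M)
    simp only [Nat.add_sub_cancel_left, Nat.add_sub_cancel] at h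
    rw [← h]
    refine Finset.sum_congr rfl fun n hn => ?_
    rw [Nat.cast_sub (Finset.mem_Ico.1 hn).2.le]
  calc _ ≤ ∑ n ∈ Finset.Ico 1 M, (M : ℝ)⁻¹ * ((n : ℝ)⁻¹ + ((M : ℝ) - n)⁻¹) := by
        refine norm_sum_le_of_le _ fun n hn => ?_
        rw [Finset.mem_Ico] at hn
        have hn1 : (1 : ℝ) ≤ n := by exact_mod_cast hn.1
        have hM0 : (0 : ℝ) < M := by exact_mod_cast (by omega : 0 < M)
        have h0 : (0 : ℝ) < (M : ℝ) - n := sub_pos.2 (Nat.cast_lt.2 hn.2)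
        rw [norm_mul, norm_div, norm_pow, norm_pow, Complex.norm_natCast]
        calc ‖z‖ ^ n / (n : ℝ) ^ (k - 1) * ‖singleSum 1 x (M - n) - singleSum 1 x M‖
            ≤ 1 / (n : ℝ) ^ 2 * (n / ((M : ℝ) - n)) := by
              gcongr
              · exact pow_le_one₀ (norm_nonneg _) hz
              · omega
              · exact norm_singleSum_sub_le hx hn.2
          _ = _ := by
              field_simp
              ring
    _ = 2 * ((M : ℝ)⁻¹ * ∑ n ∈ Finset.Ico 1 M, (n : ℝ)⁻¹) := by
        rw [← Finset.mul_sum, Finset.sum_add_distrib, hs]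
        ring

/-- The sum formula up to terms that vanish in the limit. -/
theorem tendsto_sum_doubleSum_sub {k : ℕ} (hk : 3 ≤ k) {x y : ℂ} (hx : ‖x‖ = 1) (hy : ‖y‖ = 1) :
    Tendsto (fun M : ℕ => ∑ j ∈ Finset.Icc 2 (k - 1), doubleSum j (k - j) x y M
      - (doubleSum 1 (k - 1) x (x * y) M - doubleSum 1 (k - 1) x y M
        + doubleSum (k - 1) 1 (x * y) x M - doubleSum (k - 1) 1 (x * y) y⁻¹ M
        + singleSum k (x * (x * y)) M)) atTop (𝓝 0) := by
  refine (tendsto_sum_mul_singleSum_sub hk hx.le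
    (show ‖x * y‖ ≤ 1 by rw [norm_mul, hx, hy, one_mul])).congr fun M => ?_
  have hy0 : y ≠ 0 := norm_ne_zero_iff.1 (by rw [hy]; exact one_ne_zero)
  have h1 := sum_doubleSum_add (by omega : 2 ≤ k) x hy0 M
  have h2 := singleSum_mul_singleSum 1 (k - 1) x (x * y) M
  rw [Nat.add_sub_cancel' (by omega : 1 ≤ k)] at h2
  simp only [mul_sub, Finset.sum_sub_distrib]
  rw [← Finset.sum_mul, ← h1]
  change _ - singleSum (k - 1) (x * y) M * _ = _
  linear_combination -h2

/-! ### Convergence of the series. -/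

theorem sum_inv_le_two_mul_sqrt (m : ℕ) :
    ∑ n ∈ Finset.Ico 1 (m + 1), (n : ℝ)⁻¹ ≤ 2 * √(m : ℝ) := by
  induction m with
  | zero => simp
  | succ m ih =>
    rw [Finset.sum_Ico_succ_top (by omega)]
    have hs : √(m : ℝ) ^ 2 = m := Real.sq_sqrt (Nat.cast_nonneg m)
    have ht : √((m + 1 : ℕ) : ℝ) ^ 2 = m + 1 := by
      rw [Real.sq_sqrt (Nat.cast_nonneg _), Nat.cast_add_one]
    have hs0 := Real.sqrt_nonneg (m : ℝ)
    have ht1 : 1 ≤ √((m + 1 : ℕ) : ℝ) := Real.one_le_sqrt.2 (by simp)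
    generalize √((m + 1 : ℕ) : ℝ) = t at *
    generalize √(m : ℝ) = s at *
    have hst : s ≤ t := abs_le_of_sq_le_sq' (by linarith) (by linarith) |>.2
    have h1 : (((m + 1 : ℕ) : ℝ))⁻¹ ≤ 2 * (t - s) := by
      rw [Nat.cast_add_one, ← ht, inv_le_iff_one_le_mul₀ (by positivity)]
      have h2 : (t - s) * (t + s) = 1 := by linear_combination ht - hs
      -- Since `s ≤ t` and `1 ≤ t`, `t + s ≤ 2t ≤ 2t²`; multiply by `t - s`.
      nlinarith [mul_nonneg (sub_nonneg.2 hst) (by nlinarith : 0 ≤ 2 * t ^ 2 - (t + s))]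
    linarith

theorem norm_singleSum_le {q : ℕ} (hq : 1 ≤ q) {y : ℂ} (hy : ‖y‖ ≤ 1) (m : ℕ) :
    ‖singleSum q y m‖ ≤ 2 * √(m : ℝ) := by
  calc ‖singleSum q y m‖ ≤ ∑ n ∈ Finset.Ico 1 m, (n : ℝ)⁻¹ := by
        refine norm_sum_le_of_le _ fun n hn => ?_
        have hn1 : (1 : ℝ) ≤ n := by exact_mod_cast (Finset.mem_Ico.1 hn).1
        rw [norm_div, norm_pow, norm_pow, Complex.norm_natCast, ← one_div]
        gcongr
        · exact pow_le_one₀ (norm_nonneg _) hy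
        · exact le_self_pow₀ hn1 (by omega)
    _ ≤ ∑ n ∈ Finset.Ico 1 (m + 1), (n : ℝ)⁻¹ :=
        Finset.sum_le_sum_of_subset_of_nonneg
          (Finset.Ico_subset_Ico_right (Nat.le_succ m)) fun _ _ _ => by positivity
    _ ≤ _ := sum_inv_le_two_mul_sqrt m

theorem exists_tendsto_sum_Ico_of_summable {f : ℕ → ℂ} (hf : Summable f) :
    ∃ z, Tendsto (fun M => ∑ m ∈ Finset.Ico 1 M, f m) atTop (𝓝 z) := by
  refine ⟨_, (hf.hasSum.tendsto_sum_nat.sub_const (f 0)).congr' ?_⟩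
  filter_upwards [eventually_ge_atTop 1] with M hM
  rw [Finset.range_eq_Ico, Finset.sum_eq_sum_Ico_succ_bot (by omega), add_sub_cancel_left]

/-- The inner sum is `O(√m)`, so the outer terms are `O(m^(-3/2))`. -/
theorem exists_tendsto_doubleSum {p q : ℕ} (hp : 2 ≤ p) (hq : 1 ≤ q) {x y : ℂ} (hx : ‖x‖ ≤ 1)
    (hy : ‖y‖ ≤ 1) : ∃ z, Tendsto (doubleSum p q x y) atTop (𝓝 z) := by
  have hs : Summable fun m : ℕ => x ^ m / (m : ℂ) ^ p * singleSum q y m := by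
    refine Summable.of_norm_bounded
      ((Real.summable_nat_rpow.2 (by norm_num : (-(3 / 2) : ℝ) < -1)).mul_left 2) fun m => ?_
    rcases Nat.eq_zero_or_pos m with rfl | hm
    · simp [singleSum]
    have hm1 : (1 : ℝ) ≤ m := by exact_mod_cast hm
    have hm0 : (0 : ℝ) < m := by linarith
    rw [norm_mul, norm_div, norm_pow, norm_pow, Complex.norm_natCast]
    calc ‖x‖ ^ m / (m : ℝ) ^ p * ‖singleSum q y m‖ ≤ 1 / (m : ℝ) ^ 2 * (2 * √(m : ℝ)) := by
          gcongr
          · exact pow_le_one₀ (norm_nonneg _) hx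
          · exact norm_singleSum_le hq hy m
      _ = 2 * (m : ℝ) ^ (-(3 / 2) : ℝ) := by
          rw [show (-(3 / 2) : ℝ) = 1 / 2 - (2 : ℕ) by norm_num, Real.rpow_sub hm0,
            Real.rpow_natCast, ← Real.sqrt_eq_rpow]
          ring
  obtain ⟨z, hz⟩ := exists_tendsto_sum_Ico_of_summable hs
  refine ⟨z, hz.congr fun M => ?_⟩
  simp only [doubleSum, singleSum, Finset.mul_sum]

theorem exists_tendsto_singleSum {p : ℕ} (hp : 2 ≤ p) {x : ℂ} (hx : ‖x‖ ≤ 1) :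
    ∃ z, Tendsto (singleSum p x) atTop (𝓝 z) := by
  refine exists_tendsto_sum_Ico_of_summable
    (Summable.of_norm_bounded (Real.summable_one_div_nat_pow.2 hp) fun m => ?_)
  rw [norm_div, norm_pow, norm_pow, Complex.norm_natCast]
  gcongr
  exact pow_le_one₀ (norm_nonneg _) hx

/-- Convergence of `∑ xᵐ / m` on the unit circle away from `1`, by Dirichlet's test. -/
theorem exists_tendsto_singleSum_one {x : ℂ} (hx : ‖x‖ ≤ 1) (hx1 : x ≠ 1) :
    ∃ z, Tendsto (singleSum 1 x) atTop (𝓝 z) := by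
  have ha : Antitone fun n : ℕ => 1 / ((n : ℝ) + 1) := fun a b hab => by
    dsimp only
    gcongr
  have hb (n : ℕ) : ‖∑ i ∈ Finset.range n, x ^ (i + 1)‖ ≤ 2 / ‖x - 1‖ := by
    simp only [pow_succ]
    rw [← Finset.sum_mul, geom_sum_eq hx1, norm_mul, norm_div]
    calc ‖x ^ n - 1‖ / ‖x - 1‖ * ‖x‖ ≤ ((1 : ℝ) + 1) / ‖x - 1‖ * 1 := by
          gcongr
          refine (norm_sub_le _ _).trans ?_
          rw [norm_one, norm_pow]
          gcongr
          exact pow_le_one₀ (norm_nonneg _) hx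
      _ = _ := by norm_num
  obtain ⟨z, hz⟩ := cauchySeq_tendsto_of_complete
    (ha.cauchySeq_series_mul_of_tendsto_zero_of_bounded tendsto_one_div_add_atTop_nhds_zero_nat hb)
  refine ⟨z, (tendsto_add_atTop_iff_nat 1).1 (hz.congr fun M => ?_)⟩
  rw [singleSum, Finset.sum_Ico_eq_sum_range, Nat.add_sub_cancel]
  refine Finset.sum_congr rfl fun i _ => ?_
  rw [Complex.real_smul, add_comm 1 i]
  push_cast
  rw [pow_one]
  ring

/-- The quasi-shuffle product expresses this sum through others already known to converge. -/
theorem exists_tendsto_doubleSum_one {q : ℕ} (hq : 2 ≤ q) {x y : ℂ} (hx : ‖x‖ ≤ 1)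
    (hx1 : x ≠ 1) (hy : ‖y‖ ≤ 1) : ∃ z, Tendsto (doubleSum 1 q x y) atTop (𝓝 z) := by
  obtain ⟨a, ha⟩ := exists_tendsto_singleSum_one hx hx1
  obtain ⟨b, hb⟩ := exists_tendsto_singleSum hq hy
  obtain ⟨c, hc⟩ := exists_tendsto_doubleSum hq le_rfl hy hx
  obtain ⟨d, hd⟩ := exists_tendsto_singleSum (by omega : 2 ≤ 1 + q)
    (show ‖x * y‖ ≤ 1 by rw [norm_mul]; exact mul_le_one₀ hx (norm_nonneg _) hy)
  refine ⟨_, (((ha.mul hb).sub hc).sub hd).congr fun M => ?_⟩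
  rw [singleSum_mul_singleSum]
  ring

theorem tendsto_singleSum_one_right {k : ℕ} (hk : 2 ≤ k) :
    Tendsto (singleSum k 1) atTop (𝓝 (riemannZeta k)) := by
  have hs : Summable fun n : ℕ => 1 / (n : ℂ) ^ k := by
    simpa using Summable.of_norm (f := fun n : ℕ => 1 / (n : ℂ) ^ k)
      (by simpa using Real.summable_one_div_nat_pow.2 hk)
  rw [zeta_nat_eq_tsum_of_gt_one hk]
  refine hs.hasSum.tendsto_sum_nat.congr fun M => ?_
  rw [singleSum]
  simp only [one_pow]
  refine (Finset.sum_subset (fun n hn => ?_) fun n hn hn' => ?_).symm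
  · simp only [Finset.mem_Ico, Finset.mem_range] at *
    omega
  · simp only [Finset.mem_Ico, Finset.mem_range] at *
    -- The extra term at `n = 0` is `1 / 0`, which is `0` by convention.
    simp [show n = 0 by omega, show k ≠ 0 by omega]

theorem MultipleLConverges.tendsto {N n : ℕ} {k : Fin n → ℕ} {a : Fin n → ZMod N}
    (h : MultipleLConverges N k a) :
    Tendsto (multipleLPartial N k a) atTop (𝓝 (multipleL N k a)) :=
  tendsto_nhds_limUnder h

/-! ### Translation to level `N`. -/

section Level

variable {N : ℕ} [NeZero N]

theorem rootOmega_pow_val_mul (a : ZMod N) (m : ℕ) :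
    rootOmega N ^ (a.val * m) = ZMod.stdAddChar a ^ m := by
  rw [pow_mul, ZMod.stdAddChar_apply, ZMod.toCircle_apply, rootOmega, ← Complex.exp_nat_mul]
  congr 2
  ring

theorem norm_stdAddChar (a : ZMod N) : ‖ZMod.stdAddChar a‖ = 1 :=
  AddChar.norm_apply _ _

theorem stdAddChar_ne_one {a : ZMod N} (ha : a ≠ 0) : ZMod.stdAddChar a ≠ 1 := fun h =>
  ha (ZMod.injective_stdAddChar (h.trans (AddChar.map_zero_eq_one _).symm))

theorem multipleLPartial_one (k : ℕ) (a : ZMod N) :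
    multipleLPartial N ![k] ![a] = singleSum k (ZMod.stdAddChar a) := by
  classical
  funext M
  rw [multipleLPartial, singleSum]
  refine Finset.sum_nbij' (fun m => m 0) (fun m => ![m]) ?_ ?_ ?_ ?_ ?_
  · intro m hm
    simp only [Finset.mem_filter, Fintype.mem_piFinset] at hm
    exact hm.1 0
  · intro m hm
    simp only [Finset.mem_filter, Fintype.mem_piFinset]
    exact ⟨fun i => by simpa using hm, fun i j hij => absurd hij (by simp [Subsingleton.elim i j])⟩
  · intro m _
    funext i
    rw [Subsingleton.elim i 0]
    rfl
  · intro m _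
    rfl
  · intro m _
    simp [rootOmega_pow_val_mul]

theorem multipleLPartial_two (p q : ℕ) (a b : ZMod N) :
    multipleLPartial N ![p, q] ![a, b] =
      doubleSum p q (ZMod.stdAddChar a) (ZMod.stdAddChar b) := by
  classical
  funext M
  rw [multipleLPartial, doubleSum, Finset.sum_sigma']
  refine Finset.sum_nbij' (fun m => ⟨m 0, m 1⟩) (fun m => ![m.1, m.2]) ?_ ?_ ?_ ?_ ?_
  · intro m hm
    simp only [Finset.mem_filter, Fintype.mem_piFinset, Finset.mem_Ico] at hm
    have h := hm.2 (show (0 : Fin 2) < 1 by decide)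
    simp only [Finset.mem_sigma, Finset.mem_Ico]
    exact ⟨hm.1 0, (hm.1 1).1, h⟩
  · rintro ⟨m, n⟩ hm
    simp only [Finset.mem_sigma, Finset.mem_Ico] at hm
    simp only [Finset.mem_filter, Fintype.mem_piFinset, Finset.mem_Ico]
    refine ⟨fun i => ?_, fun i j hij => ?_⟩
    · fin_cases i
      · exact hm.1
      · exact ⟨hm.2.1, hm.2.2.trans hm.1.2⟩
    · fin_cases i <;> fin_cases j
      · exact absurd hij (lt_irrefl _)
      · exact hm.2.2
      · exact absurd hij (by decide)
      · exact absurd hij (lt_irrefl _)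
  · intro m _
    funext i
    fin_cases i <;> rfl
  · rintro ⟨m, n⟩ _
    rfl
  · intro m _
    simp [rootOmega_pow_val_mul, Fin.prod_univ_two, div_mul_div_comm]

theorem multipleLConverges_one {k : ℕ} (hk : 2 ≤ k) (a : ZMod N) :
    MultipleLConverges N ![k] ![a] := by
  rw [MultipleLConverges, multipleLPartial_one]
  exact exists_tendsto_singleSum hk (norm_stdAddChar a).le

theorem multipleLConverges_two {p q : ℕ} (hp : 2 ≤ p) (hq : 1 ≤ q) (a b : ZMod N) :
    MultipleLConverges N ![p, q] ![a, b] := by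
  rw [MultipleLConverges, multipleLPartial_two]
  exact exists_tendsto_doubleSum hp hq (norm_stdAddChar a).le (norm_stdAddChar b).le

theorem multipleLConverges_one_left {q : ℕ} (hq : 2 ≤ q) {a : ZMod N} (ha : a ≠ 0) (b : ZMod N) :
    MultipleLConverges N ![1, q] ![a, b] := by
  rw [MultipleLConverges, multipleLPartial_two]
  exact exists_tendsto_doubleSum_one hq (norm_stdAddChar a).le (stdAddChar_ne_one ha)
    (norm_stdAddChar b).le

theorem multipleL_one_zero {k : ℕ} (hk : 2 ≤ k) : multipleL N ![k] ![0] = riemannZeta k := by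
  refine tendsto_nhds_unique (multipleLConverges_one hk 0).tendsto ?_
  rw [multipleLPartial_one, AddChar.map_zero_eq_one]
  exact tendsto_singleSum_one_right hk

/-- Stated as one limit because for `a = 0` the sums with leading exponent 1 need not converge
separately. -/
theorem tendsto_sum_multipleLPartial_sub {k : ℕ} (hk : 3 ≤ k) (a b : ZMod N) :
    Tendsto (fun M => ∑ j ∈ Finset.Icc 2 (k - 1), multipleLPartial N ![j, k - j] ![a, b] M
      - (multipleLPartial N ![1, k - 1] ![a, a + b] M - multipleLPartial N ![1, k - 1] ![a, b] M
        + multipleLPartial N ![k - 1, 1] ![a + b, a] M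
        - multipleLPartial N ![k - 1, 1] ![a + b, -b] M
        + multipleLPartial N ![k] ![a + (a + b)] M)) atTop (𝓝 0) := by
  simp only [multipleLPartial_one, multipleLPartial_two, AddChar.map_add_eq_mul,
    AddChar.map_neg_eq_inv]
  exact tendsto_sum_doubleSum_sub hk (norm_stdAddChar a) (norm_stdAddChar b)

theorem tendsto_sum_multipleLPartial {k : ℕ} (a b : ZMod N) :
    Tendsto (fun M => ∑ j ∈ Finset.Icc 2 (k - 1), multipleLPartial N ![j, k - j] ![a, b] M) atTop
      (𝓝 (∑ j ∈ Finset.Icc 2 (k - 1), multipleL N ![j, k - j] ![a, b])) :=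
  tendsto_finsetSum _ fun j hj => by
    rw [Finset.mem_Icc] at hj
    exact (multipleLConverges_two hj.1 (by omega) a b).tendsto

/-- The sum formula for double `L`-values with a nontrivial first character. -/
theorem sum_multipleL_of_ne_zero {k : ℕ} (hk : 3 ≤ k) {a : ZMod N} (ha : a ≠ 0) (b : ZMod N) :
    ∑ j ∈ Finset.Icc 2 (k - 1), multipleL N ![j, k - j] ![a, b] =
      multipleL N ![1, k - 1] ![a, a + b] - multipleL N ![1, k - 1] ![a, b]
        + multipleL N ![k - 1, 1] ![a + b, a] - multipleL N ![k - 1, 1] ![a + b, -b]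
        + multipleL N ![k] ![a + (a + b)] := by
  have h1 := fun c => (multipleLConverges_one_left (by omega : 2 ≤ k - 1) ha c).tendsto
  have h2 := fun c d => (multipleLConverges_two (N := N) (by omega : 2 ≤ k - 1) le_rfl c d).tendsto
  have h3 := fun c => (multipleLConverges_one (N := N) (by omega : 2 ≤ k) c).tendsto
  exact sub_eq_zero.1 (tendsto_nhds_unique ((tendsto_sum_multipleLPartial a b).sub
    (((((h1 (a + b)).sub (h1 b)).add (h2 (a + b) a)).sub (h2 (a + b) (-b))).add
      (h3 (a + (a + b))))) (tendsto_sum_multipleLPartial_sub hk a b))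

/-- The sum formula for double `L`-values with trivial first character. -/
theorem sum_multipleL_zero {k : ℕ} (hk : 3 ≤ k) (b : ZMod N) :
    ∑ j ∈ Finset.Icc 2 (k - 1), multipleL N ![j, k - j] ![0, b] =
      multipleL N ![k - 1, 1] ![b, 0] - multipleL N ![k - 1, 1] ![b, -b]
        + multipleL N ![k] ![b] := by
  have h2 := fun c d => (multipleLConverges_two (N := N) (by omega : 2 ≤ k - 1) le_rfl c d).tendsto
  have h3 := fun c => (multipleLConverges_one (N := N) (by omega : 2 ≤ k) c).tendsto
  have h := tendsto_sum_multipleLPartial_sub hk 0 b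
  -- For `a = 0` those sums are identical and cancel at every `M`.
  simp only [zero_add, sub_self] at h
  exact sub_eq_zero.1 (tendsto_nhds_unique ((tendsto_sum_multipleLPartial 0 b).sub
    (((h2 b 0).sub (h2 b (-b))).add (h3 b))) h)

end Level

theorem mainTheorem10 (k : ℕ) (hk : 3 ≤ k) :
    -- all the series that occur below converge
    (∀ j ∈ Finset.Icc 2 (k - 1), MultipleLConverges 1 ![j, k - j] (fun _ => 0)) ∧
    (∀ j ∈ Finset.Icc 2 (k - 1), ∀ a₁ a₂ : ZMod 3,
      MultipleLConverges 3 ![j, k - j] ![a₁, a₂]) ∧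
    (∀ a₁ a₂ : ZMod 3, a₁ ≠ 0 → MultipleLConverges 3 ![1, k - 1] ![a₁, a₂]) ∧
    (∀ a : ZMod 3, MultipleLConverges 3 ![k] ![a]) ∧
    -- the nine sum formulas
    (∑ j ∈ Finset.Icc 2 (k - 1), multipleZeta ![j, k - j] = riemannZeta (k : ℂ)) ∧
    (∑ j ∈ Finset.Icc 2 (k - 1), zetaThree ![j, k - j] ![1, 0] =
      zetaThree ![1, k - 1] ![1, 1] - zetaThree ![1, k - 1] ![1, 0]
        + zetaThree ![k - 1, 1] ![1, 1] - zetaThree ![k - 1, 1] ![1, 0]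
        + zetaThree ![k] ![2]) ∧
    (∑ j ∈ Finset.Icc 2 (k - 1), zetaThree ![j, k - j] ![2, 0] =
      zetaThree ![1, k - 1] ![2, 2] - zetaThree ![1, k - 1] ![2, 0]
        + zetaThree ![k - 1, 1] ![2, 2] - zetaThree ![k - 1, 1] ![2, 0]
        + zetaThree ![k] ![1]) ∧
    (∑ j ∈ Finset.Icc 2 (k - 1), zetaThree ![j, k - j] ![0, 1] =
      zetaThree ![k - 1, 1] ![1, 0] - zetaThree ![k - 1, 1] ![1, 2]
        + zetaThree ![k] ![1]) ∧
    (∑ j ∈ Finset.Icc 2 (k - 1), zetaThree ![j, k - j] ![1, 1] =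
      zetaThree ![1, k - 1] ![1, 2] - zetaThree ![1, k - 1] ![1, 1]
        + zetaThree ![k - 1, 1] ![2, 1] - zetaThree ![k - 1, 1] ![2, 2]
        + riemannZeta (k : ℂ)) ∧
    (∑ j ∈ Finset.Icc 2 (k - 1), zetaThree ![j, k - j] ![2, 1] =
      zetaThree ![1, k - 1] ![2, 0] - zetaThree ![1, k - 1] ![2, 1]
        + zetaThree ![k] ![2]) ∧
    (∑ j ∈ Finset.Icc 2 (k - 1), zetaThree ![j, k - j] ![0, 2] =
      zetaThree ![k - 1, 1] ![2, 0] - zetaThree ![k - 1, 1] ![2, 1]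
        + zetaThree ![k] ![2]) ∧
    (∑ j ∈ Finset.Icc 2 (k - 1), zetaThree ![j, k - j] ![1, 2] =
      zetaThree ![1, k - 1] ![1, 0] - zetaThree ![1, k - 1] ![1, 2]
        + zetaThree ![k] ![1]) ∧
    (∑ j ∈ Finset.Icc 2 (k - 1), zetaThree ![j, k - j] ![2, 2] =
      zetaThree ![1, k - 1] ![2, 1] - zetaThree ![1, k - 1] ![2, 2]
        + zetaThree ![k - 1, 1] ![1, 2] - zetaThree ![k - 1, 1] ![1, 1]
        + riemannZeta (k : ℂ)) := by
  have hz : (fun _ => 0 : Fin 2 → ZMod 1) = ![0, 0] := Subsingleton.elim _ _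
  have h2 (a b c d e : ZMod 3) (ha : a ≠ 0) (hc : a + b = c) (hd : -b = d) (he : a + c = e) :
      ∑ j ∈ Finset.Icc 2 (k - 1), zetaThree ![j, k - j] ![a, b] =
        zetaThree ![1, k - 1] ![a, c] - zetaThree ![1, k - 1] ![a, b]
          + zetaThree ![k - 1, 1] ![c, a] - zetaThree ![k - 1, 1] ![c, d]
          + zetaThree ![k] ![e] := by
    subst hc hd he
    exact sum_multipleL_of_ne_zero hk ha b
  have h3 : riemannZeta (k : ℂ) = zetaThree ![k] ![0] :=
    (multipleL_one_zero (by omega)).symm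
  refine ⟨fun j hj => ?_, fun j hj a b => ?_, fun a b ha => ?_, fun a => ?_, ?_, ?_, ?_, ?_, ?_,
    ?_, ?_, ?_, ?_⟩
  · rw [Finset.mem_Icc] at hj
    rw [hz]
    exact multipleLConverges_two hj.1 (by omega) 0 0
  · rw [Finset.mem_Icc] at hj
    exact multipleLConverges_two hj.1 (by omega) a b
  · exact multipleLConverges_one_left (by omega) ha b
  · exact multipleLConverges_one (by omega) a
  · simp only [multipleZeta, hz]
    rw [sum_multipleL_zero hk, multipleL_one_zero (by omega), neg_zero, sub_self, zero_add]
  · exact h2 1 0 1 0 2 (by decide) (by decide) (by decide) (by decide)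
  · exact h2 2 0 2 0 1 (by decide) (by decide) (by decide) (by decide)
  · exact sum_multipleL_zero hk 1
  · rw [h3]
    exact h2 1 1 2 2 0 (by decide) (by decide) (by decide) (by decide)
  · rw [h2 2 1 0 2 2 (by decide) (by decide) (by decide) (by decide), add_sub_cancel_right]
  · exact sum_multipleL_zero hk 2
  · rw [h2 1 2 0 1 1 (by decide) (by decide) (by decide) (by decide), add_sub_cancel_right]
  · rw [h3]
    exact h2 2 2 1 1 0 (by decide) (by decide) (by decide) (by decide)
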